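/- Let $\Gamma$ be Euler's gamma function and let $\psi(x)=\Gamma'(x)/\Gamma(x)$ for $x>0$. A function $f$ is called completely monotonic on an interval $I$ if it has derivatives of all orders on $I$ and $(-1)^n f^{(n)}(x)\ge 0$ for all $x\in I$ and all integers $n\ge 0$. For $\lambda\in\mathbb{R}$ and $x>0$ let $$f_\lambda(x)=[\psi'(x)]^2+\psi''(x)-\frac{x^2+\lambda x+12}{12x^4(x+1)^2}.$$ 1. For every $\lambda\in\mathbb{R}$, the function $f_\lambda$ is completely monotonic on $(0,\infty)$ if and only if $\lambda\le 0$. 2. For every $\lambda\in\mathbb{R}$, the function $-f_\lambda$ is completely monotonic on $(0,\infty)$ if and only if $\lambda\ge 4$. 3. For all $\mu,\nu\in\mathbb{R}$, the double inequality $$\frac{x^2+\mu x+12}{12x^4(x+1)^2}<[\psi'(x)]^2+\psi''(x)<\frac{x^2+\nu x+12}{12x^4(x+1)^2}$$ holds for all $x\in(0,\infty)$ if and only if $\mu\le 0$ and $\nu\ge 4$. -/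

import Mathlib

open scoped ContDiff

/-- The psi (digamma) function `ψ(x) = Γ'(x) / Γ(x)` of a real variable. -/
noncomputable def psi (x : ℝ) : ℝ := deriv Real.Gamma x / Real.Gamma x

/-- `f` is completely monotonic on `I`: it has derivatives of all orders on `I` and
`(-1)ⁿ f⁽ⁿ⁾(x) ≥ 0` for all `x ∈ I` and all `n ≥ 0`. -/
def CompletelyMonotonicOn (f : ℝ → ℝ) (I : Set ℝ) : Prop :=
  ContDiffOn ℝ ∞ f I ∧
    ∀ n : ℕ, ∀ x ∈ I, 0 ≤ (-1 : ℝ) ^ n * iteratedDerivWithin n f I x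

/-- The rational function `(x² + c x + 12) / (12 x⁴ (x + 1)²)`. -/
noncomputable def ratBound (c x : ℝ) : ℝ :=
  (x ^ 2 + c * x + 12) / (12 * x ^ 4 * (x + 1) ^ 2)

/-- The function `[ψ'(x)]² + ψ''(x)`. -/
noncomputable def polygammaComb (x : ℝ) : ℝ :=
  (deriv psi x) ^ 2 + iteratedDeriv 2 psi x

/-- The function `f_lam(x) = [ψ'(x)]² + ψ''(x) - (x² + lam x + 12) / (12 x⁴ (x + 1)²)`. -/
noncomputable def fLam (lam x : ℝ) : ℝ := polygammaComb x - ratBound lam x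

open Filter Topology Set

/-! Complete monotonicity is proved through alternating finite differences. Functions with
nonnegative differences contain `1/(x+a)`, `a ≥ 0`, and are stable under sums, products, shifts and
pointwise limits. If `g → 0` at infinity and `g(x) - g(x+1)` is in the class, so is `g`
(`IsAltDiff.of_sub_shift_one`).

Let P = ψ'² + ψ'' and R = 2ψ' - 2/x - 1/x². From ψ(x+1) = ψ(x) + 1/x one gets P(x) - P(x+1) =
R(x)/x² and R(x) - R(x+1) = 1/(x²(x+1)²). Hence two unit differences reduce everything to rational
functions, which are written as sums with positive coefficients. Only λ = 0 and λ = 4 need this,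
since changing λ adds a multiple of 1/(x³(x+1)²).

Necessity uses only the sign of f_λ: near 0, f_λ ~ -λ/(12x³) when λ ≠ 0; at infinity, a rational
minorant of P excludes λ < 4. -/

/-- The alternating finite differences of `f` on `(0, ∞)` up to order `n` are nonnegative. -/
def AltDiffNonneg : ℕ → (ℝ → ℝ) → Prop
  | 0, f => ∀ x, 0 < x → 0 ≤ f x
  | n + 1, f => (∀ x, 0 < x → 0 ≤ f x) ∧
      ∀ h, 0 < h → AltDiffNonneg n (fun x => f x - f (x + h))

/-- All alternating finite differences of `f` on `(0, ∞)` are nonnegative. -/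
def IsAltDiff (f : ℝ → ℝ) : Prop := ∀ n, AltDiffNonneg n f

namespace AltDiffNonneg

variable {n : ℕ} {f g : ℝ → ℝ}

theorem nonneg (hf : AltDiffNonneg n f) {x : ℝ} (hx : 0 < x) : 0 ≤ f x := by
  cases n with
  | zero => exact hf x hx
  | succ n => exact hf.1 x hx

theorem congr (hf : AltDiffNonneg n f) (h : ∀ x, 0 < x → f x = g x) : AltDiffNonneg n g := by
  induction n generalizing f g with
  | zero => exact fun x hx => h x hx ▸ hf x hx
  | succ n ih =>
    refine ⟨fun x hx => h x hx ▸ hf.1 x hx, fun d hd => ih (hf.2 d hd) fun x hx => ?_⟩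
    rw [h x hx, h (x + d) (by positivity)]

theorem of_succ (hf : AltDiffNonneg (n + 1) f) : AltDiffNonneg n f := by
  induction n generalizing f with
  | zero => exact hf.1
  | succ n ih => exact ⟨hf.1, fun d hd => ih (hf.2 d hd)⟩

theorem add (hf : AltDiffNonneg n f) (hg : AltDiffNonneg n g) :
    AltDiffNonneg n (fun x => f x + g x) := by
  induction n generalizing f g with
  | zero => exact fun x hx => add_nonneg (hf x hx) (hg x hx)
  | succ n ih =>
    refine ⟨fun x hx => add_nonneg (hf.1 x hx) (hg.1 x hx), fun d hd => ?_⟩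
    exact (ih (hf.2 d hd) (hg.2 d hd)).congr fun x _ => by ring

theorem shift (hf : AltDiffNonneg n f) {a : ℝ} (ha : 0 ≤ a) :
    AltDiffNonneg n (fun x => f (x + a)) := by
  induction n generalizing f with
  | zero => exact fun x hx => hf _ (by positivity)
  | succ n ih =>
    refine ⟨fun x hx => hf.1 _ (by positivity), fun d hd => ?_⟩
    exact (ih (hf.2 d hd)).congr fun x _ => by rw [add_right_comm]

theorem const {c : ℝ} (hc : 0 ≤ c) : AltDiffNonneg n (fun _ => c) := by
  induction n generalizing c with
  | zero => exact fun _ _ => hc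
  | succ n ih => exact ⟨fun _ _ => hc, fun d hd => (ih le_rfl).congr fun x _ => by simp⟩

/-- Discrete Leibniz rule: Δ(fg) = Δf · g + f(· + d) · Δg. -/
theorem mul (hf : AltDiffNonneg n f) (hg : AltDiffNonneg n g) :
    AltDiffNonneg n (fun x => f x * g x) := by
  induction n generalizing f g with
  | zero => exact fun x hx => mul_nonneg (hf x hx) (hg x hx)
  | succ n ih =>
    refine ⟨fun x hx => mul_nonneg (hf.1 x hx) (hg.1 x hx), fun d hd => ?_⟩
    exact ((ih (hf.2 d hd) hg.of_succ).add
      (ih (hf.of_succ.shift hd.le) (hg.2 d hd))).congr fun x _ => by ring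

/-- The difference with step `d` is d/((x+a)(x+d+a)), a product of functions already covered at the
lower order. -/
theorem inv_add {a : ℝ} (ha : 0 ≤ a) : AltDiffNonneg n (fun x => (x + a)⁻¹) := by
  induction n generalizing a with
  | zero => exact fun x hx => by positivity
  | succ n ih =>
    refine ⟨fun x hx => by positivity, fun d hd => ?_⟩
    refine (((const hd.le).mul (ih ha)).mul (ih (a := d + a) (by positivity))).congr
      fun x hx => ?_
    have : x + a ≠ 0 := by positivity
    have : x + (d + a) ≠ 0 := by positivity
    have : x + d + a ≠ 0 := by positivity
    field_simp
    ring

theorem of_tendsto {F : ℕ → ℝ → ℝ} (hF : ∀ k, AltDiffNonneg n (F k))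
    (h : ∀ x, 0 < x → Tendsto (fun k => F k x) atTop (𝓝 (f x))) : AltDiffNonneg n f := by
  induction n generalizing F f with
  | zero => exact fun x hx => ge_of_tendsto' (h x hx) fun k => hF k x hx
  | succ n ih =>
    refine ⟨fun x hx => ge_of_tendsto' (h x hx) fun k => (hF k).1 x hx, fun d hd => ?_⟩
    exact ih (fun k => (hF k).2 d hd) fun x hx => (h x hx).sub (h (x + d) (by positivity))

end AltDiffNonneg

theorem tendsto_one_div_nat_add_one_nhdsNE :
    Tendsto (fun k : ℕ => 1 / ((k : ℝ) + 1)) atTop (𝓝[≠] 0) :=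
  tendsto_nhdsWithin_iff.2 ⟨tendsto_one_div_add_atTop_nhds_zero_nat,
    Eventually.of_forall fun _ => Nat.one_div_pos_of_nat.ne'⟩

namespace IsAltDiff

variable {f g : ℝ → ℝ}

theorem nonneg (hf : IsAltDiff f) {x : ℝ} (hx : 0 < x) : 0 ≤ f x := (hf 0).nonneg hx

theorem congr (hf : IsAltDiff f) (h : ∀ x, 0 < x → f x = g x) : IsAltDiff g :=
  fun n => (hf n).congr h

theorem add (hf : IsAltDiff f) (hg : IsAltDiff g) : IsAltDiff (fun x => f x + g x) :=
  fun n => (hf n).add (hg n)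

theorem mul (hf : IsAltDiff f) (hg : IsAltDiff g) : IsAltDiff (fun x => f x * g x) :=
  fun n => (hf n).mul (hg n)

theorem const {c : ℝ} (hc : 0 ≤ c) : IsAltDiff (fun _ => c) := fun _ => .const hc

theorem inv_add {a : ℝ} (ha : 0 ≤ a) : IsAltDiff (fun x => (x + a)⁻¹) := fun _ => .inv_add ha

theorem shift (hf : IsAltDiff f) {a : ℝ} (ha : 0 ≤ a) : IsAltDiff (fun x => f (x + a)) :=
  fun n => (hf n).shift ha

theorem sub_shift (hf : IsAltDiff f) {h : ℝ} (hh : 0 < h) :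
    IsAltDiff (fun x => f x - f (x + h)) :=
  fun n => (hf (n + 1)).2 h hh

theorem pow (hf : IsAltDiff f) (k : ℕ) : IsAltDiff (fun x => f x ^ k) := by
  induction k with
  | zero => exact (const zero_le_one).congr fun x _ => by simp
  | succ k ih => exact (ih.mul hf).congr fun x _ => by rw [pow_succ]

theorem of_tendsto {F : ℕ → ℝ → ℝ} (hF : ∀ k, IsAltDiff (F k))
    (h : ∀ x, 0 < x → Tendsto (fun k => F k x) atTop (𝓝 (f x))) : IsAltDiff f :=
  fun n => .of_tendsto (fun k => hF k n) h

/-- Telescoping: `f` is the limit of f(x) - f(x+k), a sum of shifts of the unit difference. -/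
theorem of_sub_shift_one (hf : IsAltDiff (fun x => f x - f (x + 1)))
    (hlim : Tendsto f atTop (𝓝 0)) : IsAltDiff f := by
  refine of_tendsto (F := fun k x => f x - f (x + k)) (fun k => ?_) fun x _ => ?_
  · induction k with
    | zero => exact (const le_rfl).congr fun x _ => by simp
    | succ k ih =>
      refine (ih.add (hf.shift (a := k) (by positivity))).congr fun x _ => ?_
      rw [Nat.cast_succ, add_assoc x]
      ring
  · simpa using tendsto_const_nhds (x := f x) |>.sub
      (hlim.comp (tendsto_atTop_add_const_left _ x tendsto_natCast_atTop_atTop))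

theorem neg_deriv {f' : ℝ → ℝ} (hf : IsAltDiff f) (hd : ∀ x, 0 < x → HasDerivAt f (f' x) x) :
    IsAltDiff (fun x => -f' x) := by
  refine of_tendsto
    (F := fun (k : ℕ) x => ((k : ℝ) + 1) * (f x - f (x + 1 / ((k : ℝ) + 1)))) (fun k => ?_)
    fun x hx => ?_
  · exact (const (by positivity)).mul (hf.sub_shift (by positivity))
  · refine ((hasDerivAt_iff_tendsto_slope_zero.1 (hd x hx)).comp
      tendsto_one_div_nat_add_one_nhdsNE).neg.congr fun k => ?_
    simp only [Function.comp, smul_eq_mul, one_div, inv_inv]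
    ring

theorem completelyMonotonicOn (hf : IsAltDiff f) (hs : ContDiffOn ℝ ∞ f (Ioi 0)) :
    CompletelyMonotonicOn f (Ioi 0) := by
  refine ⟨hs, fun n => ?_⟩
  induction n generalizing f with
  | zero => exact fun x hx => by simpa using hf.nonneg hx
  | succ n ih =>
    intro x hx
    have hder : ∀ y, 0 < y → HasDerivAt f (derivWithin f (Ioi 0) y) y := fun y hy =>
      ((hs.differentiableOn (by simp)) y hy).hasDerivWithinAt.hasDerivAt (Ioi_mem_nhds hy)
    have := ih (hf.neg_deriv hder)
      (((contDiffOn_infty_iff_derivWithin isOpen_Ioi.uniqueDiffOn).1 hs).2.neg) x hx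
    rw [iteratedDerivWithin_succ']
    change 0 ≤ (-1 : ℝ) ^ n * iteratedDerivWithin n (-(derivWithin f (Ioi 0))) (Ioi 0) x at this
    rw [iteratedDerivWithin_neg] at this
    rw [pow_succ]
    simpa using this

end IsAltDiff

/-! ### Recurrences, monotonicity and decay of ψ, ψ', ψ'' -/

section Digamma

theorem contDiffOn_Gamma : ContDiffOn ℝ ∞ Real.Gamma (Ioi 0) := by
  intro x hx
  have hd : DifferentiableOn ℂ Complex.Gamma {z | 0 < z.re} := fun z hz =>
    (Complex.differentiableAt_Gamma z fun m hm => by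
      have hz' : 0 < z.re := hz
      rw [hm] at hz'
      have : (0 : ℝ) ≤ m := m.cast_nonneg
      simp only [Complex.neg_re, Complex.natCast_re] at hz'
      linarith).differentiableWithinAt
  have ho : IsOpen {z : ℂ | 0 < z.re} := isOpen_lt continuous_const Complex.continuous_re
  have hc : ContDiffAt ℂ ∞ Complex.Gamma (x : ℂ) :=
    (hd.contDiffOn ho).contDiffAt (ho.mem_nhds (by simpa using hx))
  refine (hc.real_of_complex.congr_of_eventuallyEq ?_).contDiffWithinAt
  exact Eventually.of_forall fun y => by simp [Complex.Gamma_ofReal]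

theorem ContDiffOn.deriv_Ioi {f : ℝ → ℝ} (hf : ContDiffOn ℝ ∞ f (Ioi 0)) :
    ContDiffOn ℝ ∞ (deriv f) (Ioi 0) :=
  ((contDiffOn_infty_iff_deriv_of_isOpen isOpen_Ioi).1 hf).2

theorem ContDiffOn.hasDerivAt_Ioi {f : ℝ → ℝ} (hf : ContDiffOn ℝ ∞ f (Ioi 0)) {x : ℝ}
    (hx : 0 < x) : HasDerivAt f (deriv f x) x :=
  ((hf.differentiableOn (by simp)).differentiableAt (Ioi_mem_nhds hx)).hasDerivAt

theorem contDiffOn_psi : ContDiffOn ℝ ∞ psi (Ioi 0) :=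
  contDiffOn_Gamma.deriv_Ioi.div contDiffOn_Gamma fun _ hx => (Real.Gamma_pos_of_pos hx).ne'

theorem contDiffOn_deriv_psi : ContDiffOn ℝ ∞ (deriv psi) (Ioi 0) := contDiffOn_psi.deriv_Ioi

theorem iteratedDeriv_two_psi : iteratedDeriv 2 psi = deriv (deriv psi) := by
  rw [iteratedDeriv_succ, iteratedDeriv_one]

theorem deriv_log_Gamma {x : ℝ} (hx : 0 < x) : deriv (Real.log ∘ Real.Gamma) x = psi x :=
  deriv.log (contDiffOn_Gamma.hasDerivAt_Ioi hx).differentiableAt (Real.Gamma_pos_of_pos hx).ne'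

theorem psi_add_one {x : ℝ} (hx : 0 < x) : psi (x + 1) = psi x + x⁻¹ := by
  have hG := contDiffOn_Gamma.hasDerivAt_Ioi hx
  have h1 : HasDerivAt (fun y => Real.Gamma (y + 1)) (deriv Real.Gamma (x + 1)) x :=
    (contDiffOn_Gamma.hasDerivAt_Ioi (x := x + 1) (by positivity)).comp_add_const x 1
  have h2 : HasDerivAt (fun y => Real.Gamma (y + 1))
      (1 * Real.Gamma x + x * deriv Real.Gamma x) x := by
    refine ((hasDerivAt_id x).mul hG).congr_of_eventuallyEq ?_
    filter_upwards [Ioi_mem_nhds hx] with y hy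
    exact Real.Gamma_add_one (ne_of_gt hy)
  have hpos := Real.Gamma_pos_of_pos hx
  rw [psi, psi, h1.unique h2, Real.Gamma_add_one hx.ne']
  field_simp
  ring

/-- This is the log-convexity of Γ. -/
theorem monotoneOn_psi : MonotoneOn psi (Ioi 0) :=
  (Real.convexOn_log_Gamma.monotoneOn_deriv fun _ hx =>
    (contDiffOn_Gamma.hasDerivAt_Ioi hx).differentiableAt.log
      (Real.Gamma_pos_of_pos hx).ne').congr fun _ hx => deriv_log_Gamma hx

theorem psi_add_nat_le {x : ℝ} (hx : 0 < x) (m : ℕ) : psi (x + m) - psi x ≤ m * x⁻¹ := by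
  induction m with
  | zero => simp
  | succ m ih =>
    have h := psi_add_one (x := x + m) (by positivity)
    have h' : (x + m)⁻¹ ≤ x⁻¹ := inv_anti₀ hx (by simp)
    rw [Nat.cast_succ, ← add_assoc, h]
    linarith

theorem tendsto_inv_add_atTop (a : ℝ) : Tendsto (fun x : ℝ => (x + a)⁻¹) atTop (𝓝 0) :=
  tendsto_inv_atTop_zero.comp (tendsto_atTop_add_const_right _ a tendsto_id)

theorem tendsto_psi_add_sub_psi {h : ℝ} (hh : 0 < h) :
    Tendsto (fun x => psi (x + h) - psi x) atTop (𝓝 0) := by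
  obtain ⟨m, hm⟩ := exists_nat_ge h
  refine tendsto_of_tendsto_of_tendsto_of_le_of_le' tendsto_const_nhds
    (h := fun x => (m : ℝ) * x⁻¹) (by simpa using tendsto_inv_atTop_zero.const_mul (m : ℝ)) ?_ ?_
  · filter_upwards [eventually_gt_atTop 0] with x hx
    exact sub_nonneg.2 (monotoneOn_psi hx (by simp; positivity) (by linarith))
  · filter_upwards [eventually_gt_atTop 0] with x hx
    refine le_trans ?_ (psi_add_nat_le hx m)
    exact sub_le_sub_right (monotoneOn_psi (by simp; positivity) (by simp; positivity)
      (by linarith)) _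

/-- The unit difference of this function is 1/x - 1/(x+h), itself a difference of `1/x`. -/
theorem isAltDiff_psi_add_sub_psi {h : ℝ} (hh : 0 < h) :
    IsAltDiff (fun x => psi (x + h) - psi x) := by
  refine IsAltDiff.of_sub_shift_one ?_ (tendsto_psi_add_sub_psi hh)
  refine ((IsAltDiff.inv_add le_rfl).sub_shift hh).congr fun x hx => ?_
  rw [add_right_comm x 1 h, psi_add_one hx, psi_add_one (x := x + h) (by positivity), add_zero,
    add_zero]
  ring

theorem isAltDiff_deriv_psi : IsAltDiff (deriv psi) := by
  refine IsAltDiff.of_tendsto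
    (F := fun (k : ℕ) x => ((k : ℝ) + 1) * (psi (x + 1 / ((k : ℝ) + 1)) - psi x)) (fun k => ?_)
    fun x hx => ?_
  · exact (IsAltDiff.const (by positivity)).mul (isAltDiff_psi_add_sub_psi (by positivity))
  · refine ((hasDerivAt_iff_tendsto_slope_zero.1
      (contDiffOn_psi.hasDerivAt_Ioi hx)).comp
        tendsto_one_div_nat_add_one_nhdsNE).congr fun k => ?_
    simp only [Function.comp, smul_eq_mul, one_div, inv_inv]

theorem isAltDiff_neg_deriv_deriv_psi : IsAltDiff (fun x => -deriv (deriv psi) x) :=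
  isAltDiff_deriv_psi.neg_deriv fun _ hx => contDiffOn_deriv_psi.hasDerivAt_Ioi hx

theorem deriv_psi_add_one {x : ℝ} (hx : 0 < x) :
    deriv psi (x + 1) = deriv psi x - (x ^ 2)⁻¹ := by
  have h1 : HasDerivAt (fun y => psi (y + 1)) (deriv psi (x + 1)) x :=
    (contDiffOn_psi.hasDerivAt_Ioi (x := x + 1) (by positivity)).comp_add_const x 1
  have h2 : HasDerivAt (fun y => psi (y + 1)) (deriv psi x + -(x ^ 2)⁻¹) x := by
    refine ((contDiffOn_psi.hasDerivAt_Ioi hx).add (hasDerivAt_inv hx.ne')).congr_of_eventuallyEq ?_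
    filter_upwards [Ioi_mem_nhds hx] with y hy using psi_add_one hy
  rw [h1.unique h2, sub_eq_add_neg]

theorem deriv_deriv_psi_add_one {x : ℝ} (hx : 0 < x) :
    deriv (deriv psi) (x + 1) = deriv (deriv psi) x + 2 / x ^ 3 := by
  have h1 : HasDerivAt (fun y => deriv psi (y + 1)) (deriv (deriv psi) (x + 1)) x :=
    (contDiffOn_deriv_psi.hasDerivAt_Ioi (x := x + 1) (by positivity)).comp_add_const x 1
  have h2 : HasDerivAt (fun y => deriv psi (y + 1))
      (deriv (deriv psi) x - -(2 * x) / (x ^ 2) ^ 2) x := by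
    have h3 : HasDerivAt (fun y : ℝ => y ^ 2) (2 * x) x := by simpa using hasDerivAt_pow 2 x
    refine ((contDiffOn_deriv_psi.hasDerivAt_Ioi hx).sub
      (h3.fun_inv (by positivity))).congr_of_eventuallyEq ?_
    filter_upwards [Ioi_mem_nhds hx] with y hy using deriv_psi_add_one hy
  rw [h1.unique h2]
  field_simp
  ring

/-- A nonnegative decreasing derivative of a function whose unit increments vanish at infinity
tends to zero. -/
theorem tendsto_zero_of_hasDerivAt_of_isAltDiff {f g : ℝ → ℝ} (hg : IsAltDiff g)
    (hd : ∀ x, 0 < x → HasDerivAt f (g x) x)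
    (hlim : Tendsto (fun x => f (x + 1) - f x) atTop (𝓝 0)) : Tendsto g atTop (𝓝 0) := by
  refine tendsto_of_tendsto_of_tendsto_of_le_of_le' tendsto_const_nhds
    (hlim.comp (tendsto_atTop_add_const_right _ (-1 : ℝ) tendsto_id)) ?_ ?_
  · filter_upwards [eventually_gt_atTop 0] with x hx using hg.nonneg hx
  · filter_upwards [eventually_gt_atTop 1] with x hx
    have hx' : x - 1 < x := by linarith
    -- The mean value theorem on [x-1, x] gives g(x) ≤ g(c) = f(x) - f(x-1).
    obtain ⟨c, ⟨hc1, hc2⟩, hc⟩ := exists_hasDerivAt_eq_slope f g hx'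
      (fun y hy => (hd y (by linarith [hy.1])).continuousAt.continuousWithinAt)
      (fun y hy => hd y (by linarith [hy.1]))
    have hmono := (hg.sub_shift (h := x - c) (by linarith)).nonneg (x := c) (by linarith)
    simp only [add_sub_cancel] at hmono
    simp only [Function.comp, id, neg_add_cancel_right, sub_sub_cancel, div_one] at hc ⊢
    rw [← sub_eq_add_neg, ← hc]
    linarith

theorem tendsto_deriv_psi : Tendsto (deriv psi) atTop (𝓝 0) :=
  tendsto_zero_of_hasDerivAt_of_isAltDiff isAltDiff_deriv_psi
    (fun _ hx => contDiffOn_psi.hasDerivAt_Ioi hx) (tendsto_psi_add_sub_psi one_pos)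

theorem tendsto_deriv_deriv_psi : Tendsto (deriv (deriv psi)) atTop (𝓝 0) := by
  have h := tendsto_zero_of_hasDerivAt_of_isAltDiff (f := fun x => -deriv psi x)
    isAltDiff_neg_deriv_deriv_psi
    (fun _ hx => (contDiffOn_deriv_psi.hasDerivAt_Ioi hx).neg) (by
      simpa using (tendsto_deriv_psi.comp
        (tendsto_atTop_add_const_right _ (1 : ℝ) tendsto_id)).neg.sub tendsto_deriv_psi.neg)
  simpa using h.neg

end Digamma

/-! ### Rational comparison, sharp constants -/

section RationalBounds

theorem IsAltDiff.const_div {c : ℝ} (hc : 0 ≤ c) (i j k l : ℕ) :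
    IsAltDiff (fun x => c / (x ^ i * (x + 1) ^ j * (x + 2) ^ k * (x + 3) ^ l)) := by
  refine (((((const hc).mul ((inv_add (a := 0) le_rfl).pow i)).mul
    ((inv_add (a := 1) (by norm_num)).pow j)).mul ((inv_add (a := 2) (by norm_num)).pow k)).mul
    ((inv_add (a := 3) (by norm_num)).pow l)).congr fun x hx => ?_
  simp only [add_zero, div_eq_mul_inv, mul_inv, inv_pow]
  ring

/-- The exponent `j + 1` forces decay; callers pass one less than the exponent of x+1. -/
theorem tendsto_const_div_zero (c : ℝ) (i j k l : ℕ) :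
    Tendsto (fun x : ℝ => c / (x ^ i * (x + 1) ^ (j + 1) * (x + 2) ^ k * (x + 3) ^ l)) atTop
      (𝓝 0) := by
  have h := ((((tendsto_const_nhds (x := c)).mul ((tendsto_inv_add_atTop 0).pow i)).mul
    ((tendsto_inv_add_atTop 1).pow (j + 1))).mul ((tendsto_inv_add_atTop 2).pow k)).mul
    ((tendsto_inv_add_atTop 3).pow l)
  rw [zero_pow j.succ_ne_zero, mul_zero, zero_mul, zero_mul] at h
  refine h.congr fun x => ?_
  simp only [add_zero, div_eq_mul_inv, mul_inv, inv_pow]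
  ring

/-- Twice the remainder `ψ'(x) - 1/x - 1/(2x²)` of the trigamma function. -/
noncomputable def trigammaRem (x : ℝ) : ℝ := 2 * deriv psi x - 2 / x - 1 / x ^ 2

theorem trigammaRem_sub {x : ℝ} (hx : 0 < x) :
    trigammaRem x - trigammaRem (x + 1) = 1 / (x ^ 2 * (x + 1) ^ 2) := by
  rw [trigammaRem, trigammaRem, deriv_psi_add_one hx]
  field_simp
  ring

theorem tendsto_trigammaRem : Tendsto trigammaRem atTop (𝓝 0) := by
  have h := ((tendsto_deriv_psi.const_mul 2).sub (tendsto_inv_atTop_zero.const_mul (2 : ℝ))).sub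
    ((tendsto_inv_atTop_zero (𝕜 := ℝ)).pow 2)
  simp only [mul_zero, sub_zero, ne_eq, OfNat.ofNat_ne_zero, not_false_eq_true, zero_pow] at h
  refine h.congr fun x => ?_
  rw [trigammaRem, div_eq_mul_inv, one_div, inv_pow]

/-- The squares of ψ' cancel, leaving an expression linear in ψ'. -/
theorem polygammaComb_sub {x : ℝ} (hx : 0 < x) :
    polygammaComb x - polygammaComb (x + 1) = trigammaRem x / x ^ 2 := by
  rw [polygammaComb, polygammaComb, iteratedDeriv_two_psi, deriv_psi_add_one hx,
    deriv_deriv_psi_add_one hx, trigammaRem]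
  field_simp
  ring

theorem tendsto_polygammaComb : Tendsto polygammaComb atTop (𝓝 0) := by
  have h := (tendsto_deriv_psi.pow 2).add tendsto_deriv_deriv_psi
  rw [← iteratedDeriv_two_psi] at h
  simpa using! h

theorem contDiffOn_polygammaComb : ContDiffOn ℝ ∞ polygammaComb (Ioi 0) := by
  have h := (contDiffOn_deriv_psi.pow 2).add contDiffOn_deriv_psi.deriv_Ioi
  rw [← iteratedDeriv_two_psi] at h
  exact h

theorem contDiffOn_ratBound (c : ℝ) : ContDiffOn ℝ ∞ (ratBound c) (Ioi 0) := by
  refine ContDiffOn.div (by fun_prop) (by fun_prop) fun x hx => ?_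
  have hx' : 0 < x := hx
  positivity

theorem contDiffOn_fLam (c : ℝ) : ContDiffOn ℝ ∞ (fLam c) (Ioi 0) :=
  contDiffOn_polygammaComb.sub (contDiffOn_ratBound c)

theorem tendsto_ratBound (c : ℝ) : Tendsto (ratBound c) atTop (𝓝 0) := by
  have h := ((tendsto_const_div_zero (1 / 12) 2 1 0 0).add
    (tendsto_const_div_zero (c / 12) 3 1 0 0)).add (tendsto_const_div_zero 1 4 1 0 0)
  simp only [add_zero] at h
  refine h.congr' ?_
  filter_upwards [eventually_gt_atTop 0] with x hx
  rw [ratBound]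
  field_simp

theorem tendsto_fLam (c : ℝ) : Tendsto (fLam c) atTop (𝓝 0) := by
  simpa using! tendsto_polygammaComb.sub (tendsto_ratBound c)

theorem fLam_eq (a b : ℝ) {x : ℝ} (hx : 0 < x) :
    fLam a x = fLam b x + (b - a) / (12 * x ^ 3 * (x + 1) ^ 2) := by
  rw [fLam, fLam, ratBound, ratBound]
  field_simp
  ring

theorem isAltDiff_trigammaRem_sub :
    IsAltDiff (fun x => trigammaRem x - 1 / (3 * x ^ 2 * (x + 1))) := by
  refine IsAltDiff.of_sub_shift_one ?_ ?_
  · refine (IsAltDiff.const_div (c := 4 / 3) (by norm_num) 2 2 1 0).congr fun x hx => ?_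
    rw [sub_sub_sub_comm, trigammaRem_sub hx]
    field_simp
    ring
  · have h := tendsto_trigammaRem.sub (tendsto_const_div_zero (1 / 3) 2 0 0 0)
    rw [sub_zero] at h
    refine h.congr fun x => ?_
    simp only [div_eq_mul_inv, mul_inv, pow_zero]
    ring

/-- Passing from R(x) to R(x+1) releases 1/(x⁴(x+1)²), which cancels the constant term 12 of the
bound. -/
theorem fLam_zero_sub {x : ℝ} (hx : 0 < x) :
    fLam 0 x - fLam 0 (x + 1) =
      (trigammaRem (x + 1) - 1 / (3 * (x + 1) ^ 2 * (x + 1 + 1))) / x ^ 2 +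
        1 / 3 / (x ^ 2 * (x + 1) ^ 2 * (x + 2) ^ 2) + 1 / ((x + 1) ^ 4 * (x + 2) ^ 2) := by
  have h := trigammaRem_sub hx
  rw [sub_eq_iff_eq_add] at h
  rw [fLam, fLam, sub_sub_sub_comm, polygammaComb_sub hx, h, ratBound, ratBound]
  have : x + 1 + 1 = x + 2 := by ring
  rw [this]
  field_simp
  ring

theorem isAltDiff_fLam_zero : IsAltDiff (fLam 0) := by
  refine IsAltDiff.of_sub_shift_one ?_ (tendsto_fLam 0)
  refine ((((isAltDiff_trigammaRem_sub.shift zero_le_one).mul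
    ((IsAltDiff.inv_add le_rfl).pow 2)).add
    (IsAltDiff.const_div (c := 1 / 3) (by norm_num) 2 2 2 0)).add
    (IsAltDiff.const_div zero_le_one 0 4 2 0)).congr fun x hx => ?_
  rw [fLam_zero_sub hx]
  simp [div_eq_mul_inv]

theorem fLam_zero_pos {x : ℝ} (hx : 0 < x) : 0 < fLam 0 x := by
  have h := fLam_zero_sub hx
  have h1 := isAltDiff_fLam_zero.nonneg (x := x + 1) (by positivity)
  have h2 := isAltDiff_trigammaRem_sub.nonneg (x := x + 1) (by positivity)
  have h3 : 0 < 1 / ((x + 1) ^ 4 * (x + 2) ^ 2) := by positivity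
  have h4 : 0 ≤ 1 / 3 / (x ^ 2 * (x + 1) ^ 2 * (x + 2) ^ 2) := by positivity
  have h5 := div_nonneg h2 (sq_nonneg x)
  linarith

theorem tendsto_sq_mul_ratBound_four_sub :
    Tendsto (fun x => x ^ 2 * (ratBound 4 x - ratBound 4 (x + 1))) atTop (𝓝 0) := by
  have h := (((((tendsto_const_div_zero 4 2 3 2 0).add
    (tendsto_const_div_zero (40 / 3) 1 3 2 0)).add
    (tendsto_const_div_zero (25 / 3) 0 3 2 0)).add (tendsto_const_div_zero 7 0 2 2 0)).add
    (tendsto_const_div_zero (5 / 3) 0 1 2 0)).add (tendsto_const_div_zero (1 / 3) 0 0 2 0)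
  simp only [add_zero] at h
  refine h.congr' ?_
  filter_upwards [eventually_gt_atTop 0] with x hx
  rw [ratBound, ratBound, show x + 1 + 1 = x + 2 by ring]
  field_simp
  ring

/-- The factor x² clears the 1/x² in front of R, so this unit difference is rational. Over the
common denominator the numerator is 48 + x·p(x+1), with p having positive coefficients. -/
theorem sq_mul_ratBound_four_sub_sub_trigammaRem_sub {x : ℝ} (hx : 0 < x) :
    (x ^ 2 * (ratBound 4 x - ratBound 4 (x + 1)) - trigammaRem x) -
      ((x + 1) ^ 2 * (ratBound 4 (x + 1) - ratBound 4 (x + 1 + 1)) - trigammaRem (x + 1)) =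
    48 / (x ^ 1 * (x + 1) ^ 4 * (x + 2) ^ 4 * (x + 3) ^ 2) +
      44 / (x ^ 0 * (x + 1) ^ 4 * (x + 2) ^ 4 * (x + 3) ^ 2) +
      128 / 3 / (x ^ 0 * (x + 1) ^ 3 * (x + 2) ^ 4 * (x + 3) ^ 2) +
      145 / 3 / (x ^ 0 * (x + 1) ^ 2 * (x + 2) ^ 4 * (x + 3) ^ 2) +
      115 / 3 / (x ^ 0 * (x + 1) ^ 1 * (x + 2) ^ 4 * (x + 3) ^ 2) +
      41 / 3 / (x ^ 0 * (x + 1) ^ 0 * (x + 2) ^ 4 * (x + 3) ^ 2) := by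
  rw [sub_sub_sub_comm, trigammaRem_sub hx, ratBound, ratBound, ratBound,
    show x + 1 + 1 = x + 2 by ring, show x + 2 + 1 = x + 3 by ring]
  field_simp
  ring

theorem isAltDiff_sq_mul_ratBound_four_sub_sub_trigammaRem :
    IsAltDiff (fun x => x ^ 2 * (ratBound 4 x - ratBound 4 (x + 1)) - trigammaRem x) := by
  refine IsAltDiff.of_sub_shift_one ?_
    (by simpa using tendsto_sq_mul_ratBound_four_sub.sub tendsto_trigammaRem)
  exact ((((((IsAltDiff.const_div (by norm_num) 1 4 4 2).add
    (IsAltDiff.const_div (by norm_num) 0 4 4 2)).add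
    (IsAltDiff.const_div (by norm_num) 0 3 4 2)).add
    (IsAltDiff.const_div (by norm_num) 0 2 4 2)).add
    (IsAltDiff.const_div (by norm_num) 0 1 4 2)).add
    (IsAltDiff.const_div (by norm_num) 0 0 4 2)).congr
    fun x hx => (sq_mul_ratBound_four_sub_sub_trigammaRem_sub hx).symm

theorem sq_mul_ratBound_four_sub_sub_trigammaRem_pos {x : ℝ} (hx : 0 < x) :
    0 < x ^ 2 * (ratBound 4 x - ratBound 4 (x + 1)) - trigammaRem x := by
  have h := sq_mul_ratBound_four_sub_sub_trigammaRem_sub hx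
  have h1 := isAltDiff_sq_mul_ratBound_four_sub_sub_trigammaRem.nonneg (x := x + 1) (by positivity)
  rw [sub_eq_iff_eq_add] at h
  rw [h]
  exact add_pos_of_pos_of_nonneg (by positivity) h1

theorem neg_fLam_four_sub {x : ℝ} (hx : 0 < x) :
    -fLam 4 x - -fLam 4 (x + 1) =
      (x ^ 2 * (ratBound 4 x - ratBound 4 (x + 1)) - trigammaRem x) * (x⁻¹) ^ 2 := by
  have h := polygammaComb_sub hx
  rw [sub_eq_iff_eq_add] at h
  rw [fLam, fLam, h]
  field_simp
  ring

theorem isAltDiff_neg_fLam_four : IsAltDiff (fun x => -fLam 4 x) := by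
  refine IsAltDiff.of_sub_shift_one ?_ (by simpa using (tendsto_fLam 4).neg)
  refine (isAltDiff_sq_mul_ratBound_four_sub_sub_trigammaRem.mul
    ((IsAltDiff.inv_add le_rfl).pow 2)).congr fun x hx => ?_
  rw [neg_fLam_four_sub hx, add_zero]

theorem fLam_four_neg {x : ℝ} (hx : 0 < x) : fLam 4 x < 0 := by
  have h := neg_fLam_four_sub hx
  have h1 := isAltDiff_neg_fLam_four.nonneg (x := x + 1) (by positivity)
  have h2 := mul_pos (sq_mul_ratBound_four_sub_sub_trigammaRem_pos hx)
    (pow_pos (inv_pos.2 hx) 2)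
  linarith

/-- A rational minorant of `polygammaComb` which has the same expansion at infinity up to
`O(x⁻⁶)`. -/
noncomputable def ratMinorant (x : ℝ) : ℝ := (x + 4) / (12 * x ^ 3 * (x + 1) ^ 2)

theorem tendsto_ratMinorant : Tendsto ratMinorant atTop (𝓝 0) := by
  have h := (tendsto_const_div_zero (1 / 12) 2 1 0 0).add
    (tendsto_const_div_zero (4 / 12) 3 1 0 0)
  simp only [add_zero] at h
  refine h.congr' ?_
  filter_upwards [eventually_gt_atTop 0] with x hx
  rw [ratMinorant]
  field_simp

theorem tendsto_sq_mul_ratMinorant_sub :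
    Tendsto (fun x => x ^ 2 * (ratMinorant x - ratMinorant (x + 1))) atTop (𝓝 0) := by
  have h := (((tendsto_const_div_zero (4 / 3) 1 2 2 0).add
    (tendsto_const_div_zero 1 0 2 2 0)).add
    (tendsto_const_div_zero (5 / 3) 0 1 2 0)).add (tendsto_const_div_zero (1 / 3) 0 0 2 0)
  simp only [add_zero] at h
  refine h.congr' ?_
  filter_upwards [eventually_gt_atTop 0] with x hx
  rw [ratMinorant, ratMinorant, show x + 1 + 1 = x + 2 by ring]
  field_simp
  ring

theorem isAltDiff_trigammaRem_sub_sq_mul_ratMinorant_sub :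
    IsAltDiff (fun x => trigammaRem x - x ^ 2 * (ratMinorant x - ratMinorant (x + 1))) := by
  refine IsAltDiff.of_sub_shift_one ?_
    (by simpa using tendsto_trigammaRem.sub tendsto_sq_mul_ratMinorant_sub)
  refine (((((IsAltDiff.const_div (c := 72) (by norm_num) 2 3 3 2).add
    (IsAltDiff.const_div (c := 204) (by norm_num) 1 3 3 2)).add
    (IsAltDiff.const_div (c := 400 / 3) (by norm_num) 0 3 3 2)).add
    (IsAltDiff.const_div (c := 196 / 3) (by norm_num) 0 2 3 2)).add
    (IsAltDiff.const_div (c := 49 / 3) (by norm_num) 0 1 3 2)).congr fun x hx => ?_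
  rw [sub_sub_sub_comm, trigammaRem_sub hx, ratMinorant, ratMinorant, ratMinorant,
    show x + 1 + 1 = x + 2 by ring, show x + 2 + 1 = x + 3 by ring]
  field_simp
  ring

theorem ratMinorant_le_polygammaComb {x : ℝ} (hx : 0 < x) : ratMinorant x ≤ polygammaComb x := by
  have h : IsAltDiff (fun x => polygammaComb x - ratMinorant x) := by
    refine IsAltDiff.of_sub_shift_one ?_
      (by simpa using tendsto_polygammaComb.sub tendsto_ratMinorant)
    refine (isAltDiff_trigammaRem_sub_sq_mul_ratMinorant_sub.mul
      ((IsAltDiff.inv_add le_rfl).pow 2)).congr fun x hx => ?_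
    rw [sub_sub_sub_comm, polygammaComb_sub hx]
    field_simp
    ring
  exact sub_nonneg.1 (h.nonneg hx)

theorem le_zero_of_fLam_nonneg {c : ℝ} (h : ∀ x, 0 < x → 0 ≤ fLam c x) : c ≤ 0 := by
  have hF : ContinuousAt polygammaComb (0 + 1) :=
    contDiffOn_polygammaComb.continuousOn.continuousAt (Ioi_mem_nhds (by norm_num))
  have hR : ContinuousAt trigammaRem (0 + 1) := by
    have := contDiffOn_deriv_psi.continuousOn.continuousAt
      (Ioi_mem_nhds (show (0 : ℝ) < 0 + 1 by norm_num))
    unfold trigammaRem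
    exact ((this.const_mul 2).sub (by fun_prop (disch := norm_num))).sub
      (by fun_prop (disch := norm_num))
  have hF' : ContinuousAt (fun x : ℝ => polygammaComb (x + 1)) 0 :=
    hF.comp (f := fun x : ℝ => x + 1) (by fun_prop)
  have hR' : ContinuousAt (fun x : ℝ => trigammaRem (x + 1)) 0 :=
    hR.comp (f := fun x : ℝ => x + 1) (by fun_prop)
  -- This function is 12x³(x+1)² f_c(x) + c, rewritten with P and R at x+1 so that it is continuous
  -- at 0.
  have hlim : Tendsto (fun x : ℝ => 12 * x ^ 3 * (x + 1) ^ 2 * polygammaComb (x + 1) +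
      12 * x * (x + 1) ^ 2 * trigammaRem (x + 1) - x) (𝓝[>] 0) (𝓝 0) := by
    have hc : ContinuousAt (fun x : ℝ => 12 * x ^ 3 * (x + 1) ^ 2 * polygammaComb (x + 1) +
      12 * x * (x + 1) ^ 2 * trigammaRem (x + 1) - x) 0 := by fun_prop
    have := hc.tendsto
    simp only [ne_eq, OfNat.ofNat_ne_zero, not_false_eq_true, zero_pow, mul_zero, zero_mul,
      add_zero, sub_zero] at this
    exact this.mono_left nhdsWithin_le_nhds
  refine ge_of_tendsto hlim ?_
  filter_upwards [self_mem_nhdsWithin] with x hx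
  have hx : 0 < x := hx
  have h0 := h x hx
  have h1 := polygammaComb_sub hx
  have h2 := trigammaRem_sub hx
  rw [sub_eq_iff_eq_add] at h1 h2
  rw [fLam, h1, h2, ratBound] at h0
  have h3 := mul_nonneg (show 0 ≤ 12 * x ^ 3 * (x + 1) ^ 2 by positivity) h0
  have h4 : 12 * x ^ 3 * (x + 1) ^ 2 * ((1 / (x ^ 2 * (x + 1) ^ 2) + trigammaRem (x + 1)) / x ^ 2 +
      polygammaComb (x + 1) - (x ^ 2 + c * x + 12) / (12 * x ^ 4 * (x + 1) ^ 2)) =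
      12 * x ^ 3 * (x + 1) ^ 2 * polygammaComb (x + 1) +
      12 * x * (x + 1) ^ 2 * trigammaRem (x + 1) - x - c := by
    field_simp
    ring
  linarith

theorem four_le_of_fLam_nonpos {c : ℝ} (h : ∀ x, 0 < x → fLam c x ≤ 0) : 4 ≤ c := by
  by_contra! hc
  -- Any x > 12/(4-c) makes the numerator 12 - (4-c)x negative; this is twice that threshold.
  have hx : 0 < 24 / (4 - c) := div_pos (by norm_num) (by linarith)
  set x := 24 / (4 - c)
  have hxc : (4 - c) * x = 24 := mul_div_cancel₀ _ (by linarith)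
  have h1 : ratMinorant x ≤ ratBound c x :=
    (ratMinorant_le_polygammaComb hx).trans (sub_nonpos.1 (h x hx))
  have h2 : ratBound c x - ratMinorant x = (12 - (4 - c) * x) / (12 * x ^ 4 * (x + 1) ^ 2) := by
    rw [ratBound, ratMinorant]
    field_simp
    ring
  have h3 : (12 - (4 - c) * x) / (12 * x ^ 4 * (x + 1) ^ 2) < 0 := by
    rw [hxc]
    exact div_neg_of_neg_of_pos (by norm_num) (by positivity)
  linarith

end RationalBounds

theorem theorem1 :
    (∀ lam : ℝ, CompletelyMonotonicOn (fLam lam) (Set.Ioi 0) ↔ lam ≤ 0) ∧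
    (∀ lam : ℝ, CompletelyMonotonicOn (fun x => -fLam lam x) (Set.Ioi 0) ↔ 4 ≤ lam) ∧
    (∀ μ ν : ℝ,
      (∀ x : ℝ, 0 < x →
        ratBound μ x < polygammaComb x ∧ polygammaComb x < ratBound ν x) ↔
      (μ ≤ 0 ∧ 4 ≤ ν)) := by
  have hterm : ∀ d : ℝ, 0 ≤ d → IsAltDiff (fun x => d / (12 * x ^ 3 * (x + 1) ^ 2)) := by
    intro d hd
    refine (IsAltDiff.const_div (c := d / 12) (by positivity) 3 2 0 0).congr fun x hx => ?_
    field_simp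
  refine ⟨fun c => ⟨fun h => le_zero_of_fLam_nonneg fun x hx => by simpa using h.2 0 x hx,
    fun hc => ?_⟩, fun c => ⟨fun h => four_le_of_fLam_nonpos fun x hx => by
      simpa using h.2 0 x hx, fun hc => ?_⟩, fun μ ν => ⟨fun h => ⟨?_, ?_⟩, ?_⟩⟩
  · refine IsAltDiff.completelyMonotonicOn ?_ (contDiffOn_fLam c)
    exact (isAltDiff_fLam_zero.add (hterm (0 - c) (by linarith))).congr
      fun x hx => (fLam_eq c 0 hx).symm
  · refine IsAltDiff.completelyMonotonicOn ?_ (contDiffOn_fLam c).neg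
    refine (isAltDiff_neg_fLam_four.add (hterm (c - 4) (by linarith))).congr fun x hx => ?_
    rw [fLam_eq c 4 hx]
    ring
  · exact le_zero_of_fLam_nonneg fun x hx => (sub_pos.2 (h x hx).1).le
  · exact four_le_of_fLam_nonpos fun x hx => (sub_neg.2 (h x hx).2).le
  · rintro ⟨hμ, hν⟩ x hx
    have h1 := fLam_zero_pos hx
    have h2 := fLam_four_neg hx
    have h3 := (hterm (0 - μ) (by linarith)).nonneg hx
    have h4 := (hterm (ν - 4) (by linarith)).nonneg hx
    have h5 := fLam_eq μ 0 hx
    have h6 := fLam_eq 4 ν hx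
    constructor
    · rw [← sub_pos]
      change 0 < fLam μ x
      linarith
    · rw [← sub_neg]
      change fLam ν x < 0
      linarith
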